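/- For a sequence $\mathbf a=(a_1,\dots,a_r)$ of positive integers and an integer $n$, let $W_1(n,\mathbf a)$ (the first Sylvester wave) be the coefficient of $t^{-1}$ in the Laurent series at $t=0$ of $$\frac{e^{nt}}{(1-e^{-a_1t})\cdots(1-e^{-a_rt})}.$$ Let $k\ge 1$ and put $\alpha_k=\lfloor\frac{k+1}{2}\rfloor$. For $1\le j\le 3k+1$ let $a[k]_j=j/2$ if $j\equiv 4\pmod 6$ and $a[k]_j=j$ otherwise, and $\mathbf a[k]=(a[k]_1,\dots,a[k]_{3k+1})$. For a finite set $J$ of positive integers let $m_J=\sum_{i\in J}(3i-1)$. The polynomial part of $\mathcal D_k(n)$, the number of plane partition diamonds of length $k$ of $n$, is the function $$\mathcal P_k(n)=\sum_{J\subseteq\{\alpha_k+1,\dots,k\}}W_1(n-m_J,\mathbf a[k]).$$ Let $\mathcal A_k=\{1\le j\le 3k+1: j\not\equiv 4\pmod 6\}$ and $D[k]=\operatorname{lcm}(\mathcal A_k)$. Let $\beta_k=5\alpha_k-2$ if $k$ is odd, $\beta_k=5\alpha_k+1$ if $k$ is even, $\mathcal B_k=\{1,\dots,\beta_k\}$,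 and let $\varphi_k:\mathcal B_k\to\mathcal A_k$ be the bijection $\varphi_k(j)=j+\lceil\frac{j-3}{5}\rceil$, with inverse $\varphi_k^{-1}(j)=j-\lceil\frac{j-3}{6}\rceil$. Let $$\mathcal B'_k=\{j\in\mathcal B_k:\ j\equiv 2\text{ or }4\pmod 5,\ j\le\varphi_k^{-1}(3\alpha_k-1)\},$$ let $\varepsilon_k(j)=2$ for $j\in\mathcal B'_k$ and $\varepsilon_k(j)=1$ for $j\in\mathcal B_k\setminus\mathcal B'_k$, and $$s_k(t_1,\dots,t_{\beta_k})=\prod_{j\in\mathcal B'_k}\left(1+\min\left\{t_j,\ 2\left(\tfrac{D[k]}{\varphi_k(j)}-1\right)-t_j\right\}\right).$$ Let $\mathbf B_k$ be the set of integer tuples $(t_1,\dots,t_{\beta_k})$ with $0\le t_j\le\varepsilon_k(j)\left(\frac{D[k]}{\varphi_k(j)}-1\right)$ for all $1\le j\le\beta_k$. Then for every integer $n$ $$\mathcal P_k(n)=\frac{1}{D[k]\,(3k)!}\sum_{J\subseteq\{\alpha_k+1,\dots,k\}}\ \sum_{(t_1,\dots,t_{\beta_k})\in\mathbf B_k}s_k(t_1,\dots,t_{\beta_k})\prod_{\ell=1}^{3k}\left(\frac{n-\sum_{j=1}^{\beta_k}t_j\varphi_k(j)-m_J}{D[k]}+\ell\right).$$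 -/

import Mathlib

open Finset
open scoped Nat

namespace PlanePartitionDiamond

noncomputable section

/-! ### Sylvester waves of a finite sequence of positive integers -/

/-- The formal power series `e^{c t}`, seen as a Laurent series in `t`. -/
def expL (c : ℂ) : LaurentSeries ℂ :=
  ((PowerSeries.rescale c (PowerSeries.exp ℂ) : PowerSeries ℂ) : LaurentSeries ℂ)

/-- The primitive root of unity `ρ_j = e^{2πi/j}`. -/
def rho (j : ℕ) : ℂ := Complex.exp (2 * Real.pi * Complex.I / j)

/-- The `j`-th Sylvester wave `W_j(n, 𝐚)` of `𝐚 = (a 1, …, a r)`: the coefficient of `t^{-1}` in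
`∑_{0 ≤ ν < j, gcd(ν, j) = 1} ρ_j^{-νn} e^{nt} / ∏_{i=1}^r (1 - ρ_j^{ν a_i} e^{-a_i t})`,
the quotient being taken in the field of formal Laurent series. -/
def sylvesterWave (r : ℕ) (a : ℕ → ℕ) (j : ℕ) (n : ℤ) : ℂ :=
  (∑ ν ∈ (range j).filter (fun ν => Nat.Coprime ν j),
    HahnSeries.C (rho j ^ (-((ν : ℤ) * n))) * expL (n : ℂ) /
      ∏ i ∈ Icc 1 r, (1 - HahnSeries.C (rho j ^ (ν * a i)) * expL (-(a i : ℂ)))).coeff (-1)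

/-! ### The data attached to plane partition diamonds of length `k` -/

/-- `α_k = ⌊(k+1)/2⌋`. -/
def alpha (k : ℕ) : ℕ := (k + 1) / 2

/-- The terms `a[k]_j` (for `1 ≤ j ≤ 3k+1`): `j/2` if `j ≡ 4 (mod 6)`, and `j` otherwise. -/
def aSeq (j : ℕ) : ℕ := if j % 6 = 4 then j / 2 else j

/-- `𝒜_k = {1 ≤ j ≤ 3k+1 : j ≢ 4 (mod 6)}`. -/
def setA (k : ℕ) : Finset ℕ := (Icc 1 (3 * k + 1)).filter (fun j => j % 6 ≠ 4)

/-- `D[k] = lcm 𝒜_k`. -/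
def D (k : ℕ) : ℕ := (setA k).lcm id

/-- `m_J = ∑_{i ∈ J} (3i-1)`; it is only used for sets `J` of positive integers. -/
def m (J : Finset ℕ) : ℕ := ∑ i ∈ J, (3 * i - 1)

/-- The sets `J ⊆ {α_k+1, …, k}`. -/
def indexSets (k : ℕ) : Finset (Finset ℕ) := (Icc (alpha k + 1) k).powerset

/-- `W_j(k, n) = ∑_J W_j(n - m_J, 𝐚[k])`. -/
def diamondWave (k j : ℕ) (n : ℤ) : ℂ :=
  ∑ J ∈ indexSets k, sylvesterWave (3 * k + 1) aSeq j (n - (m J : ℤ))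

/-- The polynomial part `P_k(n)`: the first wave `W_1(k, n)`. -/
def polynomialPart (k : ℕ) (n : ℤ) : ℂ := diamondWave k 1 n

/-- `β_k`, equal to `5α_k - 2` for odd `k` (then `α_k ≥ 1`) and to `5α_k + 1` for even `k`. -/
def beta (k : ℕ) : ℕ := if Odd k then 5 * alpha k - 2 else 5 * alpha k + 1

/-- `ℬ_k = {1, …, β_k}`. -/
def setB (k : ℕ) : Finset ℕ := Icc 1 (beta k)

/-- `φ_k(j) = j + ⌈(j-3)/5⌉`. For `j ≥ 1` the ceiling is nonnegative. -/
def phi (j : ℕ) : ℕ := j + ⌈((j : ℚ) - 3) / 5⌉₊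

/-- `φ_k⁻¹(j) = j - ⌈(j-3)/6⌉`. For `j ≥ 1` the ceiling is nonnegative and at most `j`. -/
def phiInv (j : ℕ) : ℕ := j - ⌈((j : ℚ) - 3) / 6⌉₊

/-- `ℬ'_k = {j ∈ ℬ_k : j ≡ 2, 4 (mod 5), j ≤ φ_k⁻¹(3α_k - 1)}`. -/
def setB' (k : ℕ) : Finset ℕ :=
  (setB k).filter (fun j => (j % 5 = 2 ∨ j % 5 = 4) ∧ j ≤ phiInv (3 * alpha k - 1))

/-- `ε_k(j)`, equal to `2` on `ℬ'_k` and to `1` elsewhere. -/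
def eps (k j : ℕ) : ℕ := (if j ∈ setB' k then 1 else 0) + 1

/-- The box of tuples `(t_j)_{j ∈ ℬ_k}` with `0 ≤ t_j ≤ ε_k(j) (D[k]/φ_k(j) - 1)`.
Here `φ_k(j) ∈ 𝒜_k` divides `D[k]`, so the division is exact and the quotient is positive. -/
def box (k : ℕ) : Finset (setB k → ℕ) :=
  Fintype.piFinset (fun j : setB k => Icc 0 (eps k j * (D k / phi j - 1)))

/-- `s_k(t) = ∏_{j ∈ ℬ'_k} (1 + min {t_j, 2 (D[k]/φ_k(j) - 1) - t_j})`. -/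
def s (k : ℕ) (t : setB k → ℕ) : ℤ :=
  ∏ j ∈ univ.filter (fun j : setB k => (j : ℕ) ∈ setB' k),
    (1 + min (t j : ℤ) (2 * ((D k : ℤ) / (phi j : ℤ) - 1) - (t j : ℤ)))

end

end PlanePartitionDiamond

/-!
The substitution `1 / (1 - x ^ a) = (1 + x ^ a + ⋯ + x ^ (D - a)) / (1 - x ^ D)`, valid whenever
`a ∣ D`, brings all factors of `1 / ∏ (1 - e^{-a_i t})` to the common denominator `1 - e^{-D t}`
with `D = D[k]`.  In the sequence `𝐚[k]` every element of `𝒜_k` occurs once, except that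
`2, 5, …, 3α_k - 1` (the values `j / 2` with `j ≡ 4 (mod 6)`) occur twice; in the parametrization
`φ_k : ℬ_k → 𝒜_k` the multiplicity of `φ_k(j)` is `ε_k(j)` (`prod_aSeq`).  For a doubled element
the square of the geometric sum is
`(1 + x + ⋯ + x ^ m) ^ 2 = ∑_{t ≤ 2m} (1 + min {t, 2m - t}) x ^ t` (`geom_sum_sq`), which is the
origin of the weight `s_k` and of the longer range of `t_j`.  Expanding the product gives
`1 / ∏ (1 - e^{-a_i t}) = ∑_{𝐭 ∈ 𝐁_k} s_k(𝐭) e^{-(∑ t_j φ_k(j)) t} / (1 - e^{-D t}) ^ (3k + 1)`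
(`inv_prod_one_sub_expL`).

It remains to find the residues of `F_r = e^{c t} / (1 - e^{-d t}) ^ r` (`coeff_expL_div`).
Since `F_r' = (c + r d) F_r - r d F_{r+1}` and a derivative has no residue,
`Res F_{r+1} = (c / d + r) / r * Res F_r`, starting from `Res F_1 = 1 / d`.
-/

namespace PlanePartitionDiamond

noncomputable section

/-! ### The multiplicities of the sequence `𝐚[k]` -/

lemma phi_eq (j : ℕ) : phi j = j + (j + 1) / 5 := by
  unfold phi
  congr 1
  apply le_antisymm
  · rw [Nat.ceil_le, div_le_iff₀ (by norm_num)]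
    have : j ≤ (j + 1) / 5 * 5 + 3 := by omega
    have h : (j : ℚ) ≤ ((j + 1) / 5 : ℕ) * 5 + 3 := by exact_mod_cast this
    linarith
  · rw [← Nat.lt_succ_iff, Nat.div_lt_iff_lt_mul (by norm_num)]
    have h := Nat.le_ceil (((j : ℚ) - 3) / 5)
    rw [div_le_iff₀ (by norm_num)] at h
    have h2 : (j : ℚ) ≤ ((⌈((j : ℚ) - 3) / 5⌉₊ * 5 + 3 : ℕ) : ℚ) := by push_cast; linarith
    have h3 := Nat.cast_le.mp h2
    omega

lemma phiInv_eq (j : ℕ) : phiInv j = j - (j + 2) / 6 := by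
  unfold phiInv
  congr 1
  apply le_antisymm
  · rw [Nat.ceil_le, div_le_iff₀ (by norm_num)]
    have : j ≤ (j + 2) / 6 * 6 + 3 := by omega
    have h : (j : ℚ) ≤ ((j + 2) / 6 : ℕ) * 6 + 3 := by exact_mod_cast this
    linarith
  · rw [← Nat.lt_succ_iff, Nat.div_lt_iff_lt_mul (by norm_num)]
    have h := Nat.le_ceil (((j : ℚ) - 3) / 6)
    rw [div_le_iff₀ (by norm_num)] at h
    have h2 : (j : ℚ) ≤ ((⌈((j : ℚ) - 3) / 6⌉₊ * 6 + 3 : ℕ) : ℚ) := by push_cast; linarith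
    have h3 := Nat.cast_le.mp h2
    omega

lemma beta_eq {k : ℕ} (hk : 1 ≤ k) : beta k = 3 * k + 1 - alpha k := by
  unfold beta alpha
  split_ifs with h
  · obtain ⟨i, rfl⟩ := h
    omega
  · obtain ⟨i, rfl⟩ := Nat.not_odd_iff_even.mp h
    omega

/-- The condition `j ≤ φ_k⁻¹(3α_k - 1)` says that the second occurrence of `φ_k(j)`, which is at the
index `2 φ_k(j) ≡ 4 (mod 6)`, is among the `3k + 1` terms of `𝐚[k]`. -/
lemma mem_setB' {k j : ℕ} (hk : 1 ≤ k) :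
    j ∈ setB' k ↔ (j % 5 = 2 ∨ j % 5 = 4) ∧ 2 * phi j ≤ 3 * k + 1 := by
  simp only [setB', setB, mem_filter, mem_Icc, beta_eq hk, phiInv_eq, phi_eq, alpha]
  omega

lemma phi_mem_setA {k j : ℕ} (hk : 1 ≤ k) (hj : j ∈ setB k) : phi j ∈ setA k := by
  simp only [setA, setB, mem_filter, mem_Icc, beta_eq hk, phi_eq, alpha] at *
  omega

/-- The multiset of the terms of `𝐚[k]` consists of the `φ_k(j)`, `j ∈ ℬ_k`, with multiplicities
`ε_k(j)`. -/
lemma prod_aSeq {M : Type*} [CommMonoid M] {k : ℕ} (hk : 1 ≤ k) (f : ℕ → M) :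
    ∏ i ∈ Icc 1 (3 * k + 1), f (aSeq i) = ∏ j ∈ setB k, f (phi j) ^ eps k j := by
  have hA : ∏ i ∈ (Icc 1 (3 * k + 1)).filter (fun i => i % 6 ≠ 4), f (aSeq i)
      = ∏ j ∈ setB k, f (phi j) := by
    refine prod_nbij' (fun i => i - (i + 2) / 6) phi ?_ ?_ ?_ ?_ ?_
    · intro i hi
      simp only [setB, mem_filter, mem_Icc, beta_eq hk, alpha] at *
      omega
    · intro j hj
      exact phi_mem_setA hk hj
    · intro i hi
      simp only [mem_filter, mem_Icc, phi_eq] at *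
      omega
    · intro j hj
      simp only [setB, mem_Icc, phi_eq] at *
      omega
    · intro i hi
      simp only [mem_filter, mem_Icc] at hi
      rw [aSeq, if_neg hi.2, phi_eq]
      congr 1
      omega
  have hB : ∏ i ∈ (Icc 1 (3 * k + 1)).filter (fun i => ¬ i % 6 ≠ 4), f (aSeq i)
      = ∏ j ∈ setB' k, f (phi j) := by
    refine prod_nbij' (fun i => i / 2 - (i / 2 + 2) / 6) (fun j => 2 * phi j) ?_ ?_ ?_ ?_ ?_
    · intro i hi
      simp only [mem_setB' hk, mem_filter, mem_Icc, phi_eq, not_not] at *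
      obtain ⟨q, rfl⟩ : ∃ q, i = 6 * q + 4 := ⟨i / 6, by omega⟩
      obtain ⟨p, rfl | rfl⟩ := Nat.even_or_odd' q
      · rw [show (6 * (2 * p) + 4) / 2 - ((6 * (2 * p) + 4) / 2 + 2) / 6 = 5 * p + 2 by omega]
        omega
      · rw [show (6 * (2 * p + 1) + 4) / 2 - ((6 * (2 * p + 1) + 4) / 2 + 2) / 6 = 5 * p + 4 by
          omega]
        omega
    · intro j hj
      simp only [mem_setB' hk, mem_filter, mem_Icc, phi_eq] at *
      omega
    · intro i hi
      simp only [mem_filter, mem_Icc, phi_eq] at *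
      omega
    · intro j hj
      simp only [mem_setB' hk, phi_eq] at *
      omega
    · intro i hi
      simp only [mem_filter, mem_Icc, not_not] at hi
      rw [aSeq, if_pos hi.2, phi_eq]
      congr 1
      omega
  have hsub : setB k ∩ setB' k = setB' k := inter_eq_right.mpr (filter_subset _ _)
  rw [← prod_filter_mul_prod_filter_not _ (fun i => i % 6 ≠ 4), hA, hB, ← hsub,
    ← prod_ite_mem, ← prod_mul_distrib]
  refine prod_congr rfl fun j _ => ?_
  by_cases h : j ∈ setB' k <;> simp [eps, h, pow_two]

lemma D_pos (k : ℕ) : 0 < D k := by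
  refine Nat.pos_of_ne_zero fun h => ?_
  obtain ⟨j, hj, h0⟩ := Finset.lcm_eq_zero_iff.mp h
  rw [setA, mem_filter, mem_Icc] at hj
  rw [id] at h0
  omega

lemma phi_dvd_D {k j : ℕ} (hk : 1 ≤ k) (hj : j ∈ setB k) : phi j ∣ D k :=
  Finset.dvd_lcm (f := id) (phi_mem_setA hk hj)

/-! ### The square of a geometric sum -/

lemma geom_sum_sq {R : Type*} [CommRing R] (x : R) (m : ℕ) :
    (∑ u ∈ range (m + 1), x ^ u) ^ 2
      = ∑ t ∈ Icc 0 (2 * m), ((1 + min (t : ℤ) (2 * m - t) : ℤ) : R) * x ^ t := by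
  rw [← Nat.range_succ_eq_Icc_zero]
  induction m with
  | zero => simp
  | succ m ih =>
    -- The two extreme terms of the new sum are `1` and `x ^ (2m + 2)`; shifting the others by one
    -- raises each weight of the old sum by one.
    have hshift : ∑ t ∈ range (2 * m + 1),
          ((1 + min ((t + 1 : ℕ) : ℤ) (2 * (m + 1 : ℕ) - (t + 1 : ℕ)) : ℤ) : R) * x ^ (t + 1)
        = x * (∑ u ∈ range (m + 1), x ^ u) ^ 2 + x * ∑ t ∈ range (m + (m + 1)), x ^ t := by
      rw [ih, show m + (m + 1) = 2 * m + 1 by ring, ← mul_add, ← sum_add_distrib, mul_sum]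
      refine sum_congr rfl fun t _ => ?_
      rw [show min ((t + 1 : ℕ) : ℤ) (2 * (m + 1 : ℕ) - (t + 1 : ℕ)) = min (t : ℤ) (2 * m - t) + 1
        by push_cast; omega]
      push_cast
      ring
    have hg := mul_neg_geom_sum x (m + 1)
    have hs : ∑ u ∈ range (m + 1), x ^ (m + u) = x ^ m * ∑ u ∈ range (m + 1), x ^ u := by
      simp [pow_add, mul_sum]
    have hs' : ∑ t ∈ range (m + (m + 1)), x ^ t
        = (1 + x ^ m) * (∑ u ∈ range (m + 1), x ^ u) - x ^ m := by
      rw [sum_range_add, hs, sum_range_succ _ m]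
      ring
    rw [sum_range_succ _ (m + 1), show 2 * (m + 1) + 1 = 2 * m + 1 + 1 + 1 by ring,
      sum_range_succ _ (2 * m + 1 + 1), sum_range_succ' _ (2 * m + 1), hshift, hs',
      show min ((2 * m + 1 + 1 : ℕ) : ℤ) (2 * (m + 1 : ℕ) - (2 * m + 1 + 1 : ℕ)) = 0
        by push_cast; omega,
      show min ((0 : ℕ) : ℤ) (2 * (m + 1 : ℕ) - (0 : ℕ)) = 0 by push_cast; omega]
    push_cast
    linear_combination (∑ u ∈ range (m + 1), x ^ u + 1) * hg

/-! ### The residue of `e^{c t} / (1 - e^{-d t}) ^ (r + 1)` -/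

section Residue

open PowerSeries

lemma derivative_rescale_exp (c : ℂ) :
    PowerSeries.derivative ℂ (rescale c (exp ℂ)) = C c * rescale c (exp ℂ) := by
  ext n
  have h : ((n + 1)! : ℂ) ≠ 0 := by exact_mod_cast (n + 1).factorial_ne_zero
  have h' : (n ! : ℂ) ≠ 0 := by exact_mod_cast n.factorial_ne_zero
  simp only [coeff_derivative, coeff_rescale, coeff_exp, coeff_C_mul, map_div₀, map_one,
    map_natCast]
  rw [Nat.factorial_succ] at *
  push_cast at *
  field_simp
  ring

lemma constantCoeff_rescale_exp (c : ℂ) : constantCoeff (rescale c (exp ℂ)) = 1 := by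
  rw [← coeff_zero_eq_constantCoeff_apply, coeff_rescale]
  simp

/-- The residue of `e^{c t} / (1 - e^{-d t}) ^ (r + 1)` in terms of power series: with
`1 - e^{-d t} = t u` it is the coefficient of `t ^ r` in `e^{c t} u ^ {-(r + 1)}`. -/
lemma coeff_exp_mul_inv_pow (c : ℂ) {d : ℂ} (hd : d ≠ 0) {u : PowerSeries ℂ}
    (hu : 1 - rescale (-d) (exp ℂ) = X * u) (r : ℕ) :
    coeff r (rescale c (exp ℂ) * u⁻¹ ^ (r + 1)) = 1 / (d * r !) * ∏ l ∈ Icc 1 r, (c / d + l) := by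
  -- The derivative of `t u = 1 - e^{-d t}`.
  have hdu : u + X * PowerSeries.derivative ℂ u = C d * (1 - X * u) := by
    have h := congrArg (PowerSeries.derivative ℂ) hu
    rw [map_sub, derivative_one, derivative_rescale_exp, Derivation.leibniz, derivative_X,
      smul_eq_mul, smul_eq_mul, mul_one, map_neg] at h
    linear_combination -h - C d * hu
  have hu0 : constantCoeff u = d := by
    have h := congrArg constantCoeff hdu
    simpa using h
  have huu : u * u⁻¹ = 1 := PowerSeries.mul_inv_cancel u (by rwa [hu0])
  induction r with
  | zero => simp [hu0, constantCoeff_rescale_exp]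
  | succ r ih =>
    set E := rescale c (exp ℂ) with hE
    -- The identity `F_r' = (c + r d) F_r - r d F_{r+1}`, with `r + 1` for `r`, multiplied by
    -- `t ^ (r + 2)`; the middle term comes from the derivative of `t ^ (r + 1)`.
    have key : X * PowerSeries.derivative ℂ (E * u⁻¹ ^ (r + 1))
        = X * (C (c + (r + 1) * d) * (E * u⁻¹ ^ (r + 1)))
          + C (r + 1 : ℂ) * (E * u⁻¹ ^ (r + 1)) - C ((r + 1) * d) * (E * u⁻¹ ^ (r + 1 + 1)) := by
      rw [Derivation.leibniz, derivative_pow, derivative_inv', hE, derivative_rescale_exp, ← hE]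
      simp only [smul_eq_mul, map_add, map_mul, map_natCast, map_one, Nat.add_sub_cancel]
      push_cast
      linear_combination (-(r + 1 : PowerSeries ℂ) * E * u⁻¹ ^ (r + 2)) * hdu
        + (r + 1 : PowerSeries ℂ) * E * u⁻¹ ^ (r + 1) * (1 + C d * X) * huu
    -- The terms in `coeff (r + 1) (E * u⁻¹ ^ (r + 1))` cancel: a derivative has no residue.
    have h := congrArg (coeff (r + 1)) key
    rw [map_sub, map_add, coeff_succ_X_mul, coeff_succ_X_mul, coeff_derivative, coeff_C_mul,
      coeff_C_mul, coeff_C_mul, ih] at h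
    have h' : (r ! : ℂ) ≠ 0 := by exact_mod_cast r.factorial_ne_zero
    have h1 : (r + 1 : ℂ) ≠ 0 := by exact_mod_cast r.succ_ne_zero
    rw [← mul_right_inj' (mul_ne_zero h1 hd), prod_Icc_succ_top (by omega), Nat.factorial_succ]
    push_cast
    field_simp at h ⊢
    linear_combination h

lemma one_sub_expL_ne_zero {d : ℂ} (hd : d ≠ 0) : 1 - expL (-d) ≠ 0 := by
  intro h
  have h1 : (1 - expL (-d)).coeff ((1 : ℕ) : ℤ) = 0 := by rw [h]; rfl
  rw [HahnSeries.coeff_sub, expL, LaurentSeries.coeff_coe_powerSeries, coeff_rescale] at h1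
  simp [HahnSeries.coeff_one] at h1
  exact hd h1

/-- The residue at `t = 0` of `e^{c t} / (1 - e^{-d t}) ^ (r + 1)`. -/
lemma coeff_expL_div (c : ℂ) {d : ℂ} (hd : d ≠ 0) (r : ℕ) :
    (expL c / (1 - expL (-d)) ^ (r + 1)).coeff (-1)
      = 1 / (d * r !) * ∏ l ∈ Icc 1 r, (c / d + l) := by
  obtain ⟨u, hu⟩ : X ∣ 1 - rescale (-d) (exp ℂ) := by simp [X_dvd_iff, constantCoeff_rescale_exp]
  rw [← coeff_exp_mul_inv_pow c hd hu r]
  have hL : 1 - expL (-d) = HahnSeries.single 1 1 * (u : LaurentSeries ℂ) := by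
    rw [← PowerSeries.coe_X, ← PowerSeries.coe_mul, ← hu, PowerSeries.coe_sub,
      PowerSeries.coe_one, expL]
  have hu0 : constantCoeff u ≠ 0 := by
    have h := congrArg (coeff (0 + 1)) hu
    rw [coeff_succ_X_mul, map_sub, coeff_rescale] at h
    simp [coeff_one] at h
    rwa [← h]
  have huL : (u : LaurentSeries ℂ) * ((u⁻¹ : PowerSeries ℂ) : LaurentSeries ℂ) = 1 := by
    rw [← PowerSeries.coe_mul, PowerSeries.mul_inv_cancel u hu0, PowerSeries.coe_one]
  have hX : (HahnSeries.single (1 : ℤ) (1 : ℂ)) * HahnSeries.single (-1) 1 = 1 := by simp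
  have hdiv : expL c / (1 - expL (-d)) ^ (r + 1)
      = HahnSeries.single (-1) 1 ^ (r + 1)
        * ((rescale c (exp ℂ) * u⁻¹ ^ (r + 1) : PowerSeries ℂ) : LaurentSeries ℂ) := by
    rw [div_eq_iff (pow_ne_zero _ (one_sub_expL_ne_zero hd)), hL, PowerSeries.coe_mul,
      PowerSeries.coe_pow, expL]
    have h1 := congrArg₂ (fun a b : LaurentSeries ℂ => a ^ (r + 1) * b ^ (r + 1)) hX huL
    simp only [one_pow, one_mul] at h1
    linear_combination (-((rescale c (exp ℂ) : PowerSeries ℂ) : LaurentSeries ℂ)) * h1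
  rw [hdiv, HahnSeries.single_pow, one_pow, HahnSeries.coeff_single_mul, one_mul,
    ← LaurentSeries.coeff_coe_powerSeries]
  congr 1
  simp

end Residue

/-! ### Expansion over the common denominator -/

lemma expL_zero : expL 0 = 1 := by
  simp [expL]

lemma expL_mul (a b : ℂ) : expL a * expL b = expL (a + b) := by
  rw [expL, expL, expL, ← PowerSeries.coe_mul, PowerSeries.exp_mul_exp_eq_exp_add]

lemma expL_pow (a : ℂ) (n : ℕ) : expL a ^ n = expL (n * a) := by
  induction n with
  | zero => simp [expL_zero]
  | succ n ih => rw [pow_succ, ih, expL_mul]; push_cast; ring_nf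

lemma prod_expL {ι : Type*} (S : Finset ι) (f : ι → ℂ) :
    ∏ i ∈ S, expL (f i) = expL (∑ i ∈ S, f i) := by
  classical
  induction S using Finset.induction_on with
  | empty => simp [expL_zero]
  | insert i S hi ih => rw [prod_insert hi, sum_insert hi, ih, expL_mul]

lemma sylvesterWave_one (r : ℕ) (a : ℕ → ℕ) (n : ℤ) :
    sylvesterWave r a 1 n = (expL n / ∏ i ∈ Icc 1 r, (1 - expL (-(a i : ℂ)))).coeff (-1) := by
  simp [sylvesterWave]

lemma inv_one_sub_expL {a d : ℕ} (had : a ∣ d) (hd : 0 < d) :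
    (1 - expL (-(a : ℂ)))⁻¹
      = (∑ u ∈ range (d / a), expL (-(a : ℂ)) ^ u) / (1 - expL (-(d : ℂ))) := by
  have ha : (a : ℂ) ≠ 0 := by exact_mod_cast (Nat.pos_of_dvd_of_pos had hd).ne'
  have hd' : (d : ℂ) ≠ 0 := by exact_mod_cast hd.ne'
  have h1 := one_sub_expL_ne_zero ha
  rw [inv_eq_one_div, div_eq_div_iff h1 (one_sub_expL_ne_zero hd'), one_mul,
    geom_sum_mul_neg, expL_pow]
  congr 2
  rw [mul_neg, ← Nat.cast_mul, Nat.div_mul_cancel had]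

/-- The factor of `s_k(𝐭)` that belongs to `j`, with value `1` off `ℬ'_k`. It is the coefficient
of `x ^ t` in `(1 + x + ⋯ + x ^ (D[k] / φ_k(j) - 1)) ^ ε_k(j)`. -/
def weight (k j t : ℕ) : ℤ :=
  if j ∈ setB' k then 1 + min (t : ℤ) (2 * ((D k : ℤ) / (phi j : ℤ) - 1) - (t : ℤ)) else 1

lemma s_eq_prod_weight (k : ℕ) (t : setB k → ℕ) : s k t = ∏ j : setB k, weight k j (t j) := by
  rw [s, prod_filter]
  rfl

lemma inv_one_sub_expL_pow {k j : ℕ} (hk : 1 ≤ k) (hj : j ∈ setB k) :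
    (1 - expL (-(phi j : ℂ)))⁻¹ ^ eps k j
      = (∑ t ∈ Icc 0 (eps k j * (D k / phi j - 1)),
          (weight k j t : LaurentSeries ℂ) * expL (-(t * phi j : ℂ)))
        * (1 - expL (-(D k : ℂ)))⁻¹ ^ eps k j := by
  have hdvd := phi_dvd_D hk hj
  obtain ⟨q, hq⟩ : ∃ q, D k / phi j = q + 1 :=
    Nat.exists_eq_succ_of_ne_zero (Nat.div_pos (Nat.le_of_dvd (D_pos k) hdvd)
      (Nat.pos_of_dvd_of_pos hdvd (D_pos k))).ne'
  have hqZ : (D k : ℤ) / (phi j : ℤ) = q + 1 := by exact_mod_cast hq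
  rw [inv_one_sub_expL hdvd (D_pos k), div_eq_mul_inv, mul_pow, hq, Nat.add_sub_cancel]
  congr 1
  have hterm (t : ℕ) : expL (-(t * phi j : ℂ)) = expL (-(phi j : ℂ)) ^ t := by
    rw [expL_pow, mul_neg]
  simp only [hterm, weight, hqZ, eps]
  split_ifs with h
  · rw [geom_sum_sq]
    simp
  · simp [← Nat.range_succ_eq_Icc_zero]

/-- The expansion of `1 / ∏ (1 - e^{-a_i t})` over the common denominator
`(1 - e^{-D[k] t}) ^ (3k + 1)`. -/
lemma inv_prod_one_sub_expL {k : ℕ} (hk : 1 ≤ k) :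
    (∏ i ∈ Icc 1 (3 * k + 1), (1 - expL (-(aSeq i : ℂ))))⁻¹
      = (∑ t ∈ box k, (s k t : LaurentSeries ℂ) * expL (-∑ j : setB k, (t j * phi j : ℂ)))
        / (1 - expL (-(D k : ℂ))) ^ (3 * k + 1) := by
  -- The multiplicities `ε_k(j)` add up to `3k + 1`.
  have hD := prod_aSeq hk (fun _ => (1 - expL (-(D k : ℂ)))⁻¹)
  rw [prod_const, Nat.card_Icc, Nat.add_sub_cancel] at hD
  rw [← prod_inv_distrib, prod_aSeq hk (fun a => (1 - expL (-(a : ℂ)))⁻¹), div_eq_mul_inv,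
    ← inv_pow, hD, prod_congr rfl fun j hj => inv_one_sub_expL_pow hk hj, prod_mul_distrib]
  congr 1
  rw [← prod_coe_sort, prod_univ_sum]
  refine sum_congr rfl fun t _ => ?_
  rw [prod_mul_distrib, prod_expL, s_eq_prod_weight, sum_neg_distrib]
  push_cast
  rfl

lemma sylvesterWave_one_aSeq {k : ℕ} (hk : 1 ≤ k) (n : ℤ) :
    sylvesterWave (3 * k + 1) aSeq 1 n
      = ∑ t ∈ box k, (s k t : ℂ) * (1 / ((D k : ℂ) * ((3 * k)! : ℂ)) *
          ∏ l ∈ Icc 1 (3 * k),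
            (((n : ℂ) - ∑ j : setB k, (t j : ℂ) * (phi j : ℂ)) / (D k : ℂ) + l)) := by
  have hd : (D k : ℂ) ≠ 0 := by exact_mod_cast (D_pos k).ne'
  rw [sylvesterWave_one, div_eq_mul_inv, inv_prod_one_sub_expL hk, sum_div, mul_sum,
    HahnSeries.coeff_sum]
  refine sum_congr rfl fun t _ => ?_
  rw [← coeff_expL_div _ hd, sub_eq_add_neg (n : ℂ), ← expL_mul,
    ← smul_eq_mul (s k t : ℂ), ← HahnSeries.coeff_smul, ← HahnSeries.C_mul_eq_smul, map_intCast]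
  congr 1
  ring

end

end PlanePartitionDiamond

theorem theorem5p2 (k : ℕ) (hk : 1 ≤ k) (n : ℤ) :
    PlanePartitionDiamond.polynomialPart k n =
      1 / ((PlanePartitionDiamond.D k : ℂ) * ((3 * k)! : ℂ)) *
        ∑ J ∈ PlanePartitionDiamond.indexSets k, ∑ t ∈ PlanePartitionDiamond.box k,
          (PlanePartitionDiamond.s k t : ℂ) *
            ∏ l ∈ Finset.Icc 1 (3 * k),
              (((n : ℂ)
                  - ∑ j : PlanePartitionDiamond.setB k,
                      (t j : ℂ) * (PlanePartitionDiamond.phi (j : ℕ) : ℂ)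
                  - (PlanePartitionDiamond.m J : ℂ)) / (PlanePartitionDiamond.D k : ℂ)
                + (l : ℂ)) := by
  rw [PlanePartitionDiamond.polynomialPart, PlanePartitionDiamond.diamondWave, Finset.mul_sum]
  refine Finset.sum_congr rfl fun J _ => ?_
  rw [PlanePartitionDiamond.sylvesterWave_one_aSeq hk, Finset.mul_sum]
  refine Finset.sum_congr rfl fun t _ => ?_
  rw [mul_left_comm]
  push_cast
  simp only [sub_right_comm]
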